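/- Let $G$ be a finite nilpotent group and let $g\in G$. Write $g^G$ for the conjugacy class of $g$ in $G$, $\mathrm{Cl}(G)$ for the set of conjugacy classes of $G$, and $\mathrm{Irr}(G)$ for the set of irreducible complex characters of $G$; a character $\chi\in\mathrm{Irr}(G)$ is called nonlinear if $\chi(1)\neq 1$. If $|g^G|>\frac{|G|}{|\mathrm{Cl}(G)|}$, then $\chi(g)=0$ for more than half of the nonlinear $\chi\in\mathrm{Irr}(G)$. If $|g^G|=\frac{|G|}{|\mathrm{Cl}(G)|}$, then $\chi(g)=0$ for at least half of the nonlinear $\chi\in\mathrm{Irr}(G)$. -/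

import Mathlib

/-- The set `Irr(G)` of irreducible complex characters of `G`: the functions `χ : G → ℂ` that are
characters `g ↦ tr (ρ g)` of irreducible finite-dimensional complex representations `ρ` of `G`.
Every finite-dimensional complex vector space is isomorphic to one in `Type`, so the universe of
`V` is no restriction. -/
def Irr (G : Type*) [Group G] : Set (G → ℂ) :=
  {χ | ∃ (V : Type) (_ : AddCommGroup V) (_ : Module ℂ V) (_ : FiniteDimensional ℂ V)
    (ρ : Representation ℂ G V), ρ.IsIrreducible ∧ ρ.character = χ}

/-- The nonlinear irreducible characters of `G`: those `χ ∈ Irr(G)` whose degree `χ(1)` is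
not `1`. -/
def nonlinearIrr (G : Type*) [Group G] : Set (G → ℂ) :=
  {χ ∈ Irr G | χ 1 ≠ 1}

/-- A finite group has finitely many irreducible characters, so that counting them by
`Set.ncard` is meaningful. -/
theorem Irr_finite (G : Type*) [Group G] [Finite G] : (Irr G).Finite := by
  classical
  cases nonempty_fintype G
  have hG : (Nat.card G : ℂ) ≠ 0 := by exact_mod_cast Nat.card_pos.ne'
  let _ : Invertible (Nat.card G : ℂ) := invertibleOfNonzero hG
  have key : ∀ χ ∈ Irr G, ∀ ψ ∈ Irr G,
      (Nat.card G : ℂ)⁻¹ * ∑ g : G, χ g * ψ g⁻¹ = if χ = ψ then 1 else 0 := by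
    rintro _ ⟨V, _, _, _, ρ, hρ, rfl⟩ _ ⟨W, _, _, _, σ, hσ, rfl⟩
    have h := Representation.char_orthonormal ρ σ
    split_ifs with hc
    · have h' := Representation.char_orthonormal ρ ρ
      rw [if_pos ⟨Representation.Equiv.refl ρ⟩] at h'
      rw [← hc]
      simpa using h'
    · rw [if_neg] at h
      · simpa using h
      · rintro ⟨φ⟩
        exact hc (Representation.char_iso φ).symm
  have hli : LinearIndependent ℂ (fun χ : Irr G => (χ : G → ℂ)) := by
    rw [linearIndependent_iff']
    intro s c hc ψ hψ
    have h1 : ∑ g : G, (∑ χ ∈ s, c χ • (χ : G → ℂ)) g * (ψ : G → ℂ) g⁻¹ = 0 := by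
      rw [hc]; simp
    have h2 : ∑ g : G, (∑ χ ∈ s, c χ • (χ : G → ℂ)) g * (ψ : G → ℂ) g⁻¹
        = ∑ χ ∈ s, c χ * ∑ g : G, (χ : G → ℂ) g * (ψ : G → ℂ) g⁻¹ := by
      simp only [Finset.sum_apply, Pi.smul_apply, smul_eq_mul, Finset.sum_mul, Finset.mul_sum]
      rw [Finset.sum_comm]
      simp only [mul_assoc]
    have h3 : ∀ χ : Irr G, ∑ g : G, (χ : G → ℂ) g * (ψ : G → ℂ) g⁻¹
        = if χ = ψ then (Nat.card G : ℂ) else 0 := by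
      intro χ
      have h := key χ χ.2 ψ ψ.2
      rw [inv_mul_eq_iff_eq_mul₀ hG] at h
      rw [h]
      simp [Subtype.ext_iff]
    rw [h2] at h1
    simp only [h3, mul_ite, mul_zero, Finset.sum_ite_eq', hψ, if_true] at h1
    exact (mul_eq_zero.mp h1).resolve_right hG
  exact Set.finite_coe_iff.mp hli.finite

/-! The engine is a Galois average. If χ is nonlinear and χ(g) ≠ 0, then |χ(g^k)|² averages at least
2 over the residues k prime to |G| (`two_mul_totient_le_sum_norm_sq`), whereas for linear χ it is
always 1. The elements g^k have classes of the same size, so averaging column orthogonality gives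
|g^G|(2w + l) ≤ |G|, where w counts the nonlinear characters not vanishing at g and l the linear
ones. If z nonlinear characters vanish at g, then |Cl(G)| ≤ |Irr(G)| = l + w + z; comparison gives w
< z, or w ≤ z in the equality case.

For the average, let ρ afford χ. Nilpotency yields p-elements h, x whose images commute up to a
primitive p-th root of unity. Write g = ab with a of p-power order and b of order prime to p. Both h
and x commute with b, and a determinant shows that p divides the dimension of each eigenspace of
ρ(b); hence χ(b) is p times a cyclotomic integer. Let α_r be the trace of b on the ω^r-eigenspace of
a, with ω of order Qp = p^(m+1). Parseval turns the sum of |χ|² over conjugates into the spread of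
the α_r along the cosets r = t + Qu. A nonzero difference of two α's has squared modulus at least 1
on average over its conjugates (its norm is a nonzero integer, then AM-GM), so a nonconstant coset
contributes at least 1 to the average. Two such cosets suffice. If there is only one, divisibility
by p makes its mean a cyclotomic integer, and at least two entries differ from the mean, which again
gives 2. -/

/-! ### Cyclotomic integers: norms and AM-GM -/

theorem card_le_sum_of_one_le_prod {ι : Type*} [Fintype ι] (x : ι → ℝ) (hx : ∀ i, 0 ≤ x i)
    (h : 1 ≤ ∏ i, x i) : (Fintype.card ι : ℝ) ≤ ∑ i, x i := by
  have hpos : ∀ i, 0 < x i := fun i => by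
    refine lt_of_le_of_ne (hx i) fun h0 => ?_
    rw [Finset.prod_eq_zero (Finset.mem_univ i) h0.symm] at h
    linarith
  have hlog : 0 ≤ ∑ i, Real.log (x i) := by
    rw [← Real.log_prod fun i _ => (hpos i).ne']
    exact Real.log_nonneg h
  have hle : ∑ i, (Real.log (x i) + 1) ≤ ∑ i, x i :=
    Finset.sum_le_sum fun i _ => by linarith [Real.log_le_sub_one_of_pos (hpos i)]
  rw [Finset.sum_add_distrib] at hle
  simp only [Finset.sum_const, Finset.card_univ, nsmul_eq_mul, mul_one] at hle
  linarith

/-- The values of an integral polynomial at the conjugates of a root of unity. -/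
noncomputable def conjugateValues (n : ℕ) (η : ℂ) : AddSubgroup ((ZMod n)ˣ → ℂ) :=
  (AddMonoidHom.mk' (fun (P : Polynomial ℤ) (j : (ZMod n)ˣ) =>
    Polynomial.aeval (η ^ (j : ZMod n).val) P) (fun P Q => by ext j; simp)).range

theorem mem_conjugateValues {n : ℕ} {η : ℂ} {D : (ZMod n)ˣ → ℂ} :
    D ∈ conjugateValues n η ↔
      ∃ P : Polynomial ℤ, ∀ j : (ZMod n)ˣ, Polynomial.aeval (η ^ (j : ZMod n).val) P = D j := by
  simp [conjugateValues, AddMonoidHom.mem_range, funext_iff]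

theorem sum_pow_mem_conjugateValues {n : ℕ} {η : ℂ} {ι : Type*} (s : Finset ι) (c : ι → ℤ)
    (e : ι → ℕ) :
    (fun j : (ZMod n)ˣ => ∑ i ∈ s, (c i : ℂ) * (η ^ (j : ZMod n).val) ^ e i) ∈
      conjugateValues n η :=
  mem_conjugateValues.mpr ⟨∑ i ∈ s, Polynomial.C (c i) * Polynomial.X ^ e i, fun j => by simp⟩

/-- The product is the resultant of P with the cyclotomic polynomial, which is monic with integer
coefficients. -/
theorem prod_primitiveRoots_aeval_eq_intCast {n : ℕ} (hn : n ≠ 0) (P : Polynomial ℤ) :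
    ∃ m : ℤ, ∏ ξ ∈ primitiveRoots n ℂ, Polynomial.aeval ξ P = m := by
  refine ⟨(Polynomial.cyclotomic n ℤ).resultant P
    (Polynomial.cyclotomic n ℂ).natDegree P.natDegree, ?_⟩
  have : NeZero (n : ℂ) := ⟨by exact_mod_cast hn⟩
  have h := Polynomial.resultant_eq_prod_eval (Polynomial.cyclotomic n ℂ)
    (P.map (Int.castRingHom ℂ)) P.natDegree Polynomial.natDegree_map_le
    (IsAlgClosed.splits _)
  rw [(Polynomial.cyclotomic.monic n ℂ).leadingCoeff, one_pow, one_mul,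
    ← Polynomial.map_cyclotomic_int n ℂ, Polynomial.resultant_map_map,
    Polynomial.map_cyclotomic_int n ℂ] at h
  rw [eq_intCast] at h
  rw [h, Finset.prod, ← Polynomial.cyclotomic.roots_eq_primitiveRoots_val]
  simp [Polynomial.aeval_def, Polynomial.eval_map]

theorem prod_units_pow_eq_prod_primitiveRoots {n : ℕ} [NeZero n] {η : ℂ}
    (hη : IsPrimitiveRoot η n) (f : ℂ → ℂ) :
    ∏ j : (ZMod n)ˣ, f (η ^ (j : ZMod n).val) = ∏ ξ ∈ primitiveRoots n ℂ, f ξ := by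
  refine Finset.prod_bij (fun j _ => η ^ (j : ZMod n).val) ?_ ?_ ?_ fun _ _ => rfl
  · intro j _
    rw [mem_primitiveRoots (NeZero.pos n)]
    exact hη.pow_of_coprime _ (ZMod.val_coe_unit_coprime j)
  · intro i _ j _ hij
    exact Units.ext (ZMod.val_injective n
      (hη.pow_inj (ZMod.val_lt _) (ZMod.val_lt _) hij))
  · intro ξ hξ
    rw [mem_primitiveRoots (NeZero.pos n)] at hξ
    obtain ⟨i, hi, hc, rfl⟩ := hη.isPrimitiveRoot_iff.mp hξ
    exact ⟨ZMod.unitOfCoprime i hc, Finset.mem_univ _, by simp [ZMod.val_natCast_of_lt hi]⟩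

/-- All conjugates of η share a minimal polynomial, so one vanishing value forces all to vanish.
Otherwise the product of the values is a nonzero integer, and AM-GM applies to the squared moduli.
-/
theorem card_le_sum_norm_sq_of_mem_conjugateValues {n : ℕ} [NeZero n] {η : ℂ}
    (hη : IsPrimitiveRoot η n) {D : (ZMod n)ˣ → ℂ} (hD : D ∈ conjugateValues n η) (h0 : D ≠ 0) :
    (Fintype.card (ZMod n)ˣ : ℝ) ≤ ∑ j, ‖D j‖ ^ 2 := by
  obtain ⟨P, hP⟩ := mem_conjugateValues.mp hD
  have hmin (j : (ZMod n)ˣ) : D j = 0 ↔ minpoly ℤ η ∣ P := by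
    rw [← hP, hη.minpoly_eq_pow_coprime (ZMod.val_coe_unit_coprime j)]
    exact minpoly.isIntegrallyClosed_dvd_iff
      ((hη.pow_of_coprime _ (ZMod.val_coe_unit_coprime j)).isIntegral (NeZero.pos n)) P
  have hne (j : (ZMod n)ˣ) : D j ≠ 0 := by
    intro hj
    refine h0 (funext fun i => ?_)
    rw [Pi.zero_apply, hmin i, ← hmin j, hj]
  obtain ⟨m, hm⟩ := prod_primitiveRoots_aeval_eq_intCast (NeZero.ne n) P
  rw [← prod_units_pow_eq_prod_primitiveRoots hη fun ξ => Polynomial.aeval ξ P] at hm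
  simp only [hP] at hm
  refine card_le_sum_of_one_le_prod _ (fun j => sq_nonneg _) ?_
  rw [Finset.prod_pow, ← norm_prod, hm, Complex.norm_intCast]
  have hm0 : m ≠ 0 := by
    rintro rfl
    rw [Int.cast_zero, Finset.prod_eq_zero_iff] at hm
    obtain ⟨j, _, hj⟩ := hm
    exact hne j hj
  have : (1 : ℝ) ≤ |(m : ℝ)| := by exact_mod_cast Int.one_le_abs hm0
  nlinarith

/-! ### Pairwise distances and Parseval -/

theorem sum_norm_sub_sq {U : Type*} [Fintype U] (a : U → ℂ) :
    ∑ u, ∑ v, ‖a u - a v‖ ^ 2 =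
      2 * (Fintype.card U * ∑ u, ‖a u‖ ^ 2 - ‖∑ u, a u‖ ^ 2) := by
  have key : ∀ x y : ℂ, ((‖x - y‖ ^ 2 : ℝ) : ℂ) = (‖x‖ ^ 2 : ℝ) + (‖y‖ ^ 2 : ℝ)
      - x * (starRingEnd ℂ) y - y * (starRingEnd ℂ) x := by
    intro x y
    push_cast
    simp only [← Complex.mul_conj']
    rw [map_sub]; ring
  have h2 : ((‖∑ u, a u‖ ^ 2 : ℝ) : ℂ) = ∑ u, ∑ v, a u * (starRingEnd ℂ) (a v) := by
    push_cast
    rw [← Complex.mul_conj', map_sum, Finset.sum_mul_sum]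
  have h3 : ∑ u, ∑ v, a v * (starRingEnd ℂ) (a u) = ∑ u, ∑ v, a u * (starRingEnd ℂ) (a v) :=
    Finset.sum_comm
  apply Complex.ofReal_injective
  rw [Complex.ofReal_sum]
  simp only [Complex.ofReal_sum, key, Finset.sum_sub_distrib, Finset.sum_add_distrib]
  rw [h3]
  simp only [Complex.ofReal_mul, Complex.ofReal_sub, h2, Complex.ofReal_sum,
    Finset.sum_const, Finset.card_univ, nsmul_eq_mul, ← Finset.mul_sum]
  push_cast
  ring

theorem sum_norm_sq_sum_mul_pow {M : ℕ} {z : ℂ} (hz : IsPrimitiveRoot z M) (b : Fin M → ℂ) :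
    ∑ l : Fin M, ‖∑ t : Fin M, b t * z ^ ((l : ℕ) * t)‖ ^ 2 = M * ∑ t, ‖b t‖ ^ 2 := by
  rcases Nat.eq_zero_or_pos M with rfl | hM
  · simp
  have hz0 : z ≠ 0 := hz.ne_zero hM.ne'
  have hconj : (starRingEnd ℂ) z = z⁻¹ := by
    rw [Complex.inv_def, Complex.normSq_eq_norm_sq, hz.norm'_eq_one hM.ne']; simp
  have horth : ∀ t s : Fin M, ∑ l : Fin M, z ^ ((l : ℕ) * t) * (z⁻¹) ^ ((l : ℕ) * s) =
      if t = s then (M : ℂ) else 0 := by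
    intro t s
    have h1 : ∀ l : Fin M, z ^ ((l : ℕ) * t) * (z⁻¹) ^ ((l : ℕ) * s) =
        (z ^ (t : ℕ) * (z⁻¹) ^ (s : ℕ)) ^ (l : ℕ) := by
      intro l; rw [mul_pow, ← pow_mul, ← pow_mul, mul_comm (t : ℕ), mul_comm (s : ℕ)]
    simp only [h1]
    rw [Fin.sum_univ_eq_sum_range fun l => (z ^ (t : ℕ) * (z⁻¹) ^ (s : ℕ)) ^ l]
    split_ifs with h
    · subst h
      rw [← mul_pow, mul_inv_cancel₀ hz0]; simp
    · have hne : z ^ (t : ℕ) * (z⁻¹) ^ (s : ℕ) ≠ 1 := by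
        intro h1
        rw [inv_pow, mul_inv_eq_one₀ (pow_ne_zero _ hz0)] at h1
        exact h (Fin.ext (hz.pow_inj t.2 s.2 h1))
      have hpow : (z ^ (t : ℕ) * (z⁻¹) ^ (s : ℕ)) ^ M = 1 := by
        rw [mul_pow, pow_right_comm, pow_right_comm z⁻¹, inv_pow z M, hz.pow_eq_one]
        simp
      have := mul_neg_geom_sum (z ^ (t : ℕ) * (z⁻¹) ^ (s : ℕ)) M
      rw [hpow, sub_self, mul_eq_zero] at this
      exact this.resolve_left (sub_ne_zero.mpr hne.symm)
  apply Complex.ofReal_injective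
  push_cast
  simp only [← Complex.mul_conj', map_sum, map_mul, map_pow, hconj, Finset.sum_mul_sum]
  rw [Finset.sum_comm, Finset.mul_sum]
  refine Finset.sum_congr rfl fun t _ => ?_
  rw [Finset.sum_comm]
  have : ∀ s : Fin M, ∑ l : Fin M, b t * z ^ ((l : ℕ) * t) *
      ((starRingEnd ℂ) (b s) * z⁻¹ ^ ((l : ℕ) * s)) =
      b t * (starRingEnd ℂ) (b s) * if t = s then (M : ℂ) else 0 := by
    intro s
    rw [← horth, Finset.mul_sum]
    exact Finset.sum_congr rfl fun l _ => by ring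
  simp only [this, mul_ite, mul_zero, Finset.sum_ite_eq, Finset.mem_univ, if_true]
  ring

/-- The sum over `j` of half the squared distances between the values `a u j`. -/
noncomputable def totalSpread {U J : Type*} [Fintype U] [Fintype J] (a : U → J → ℂ) : ℝ :=
  ∑ j, (Fintype.card U * ∑ u, ‖a u j‖ ^ 2 - ‖∑ u, a u j‖ ^ 2)

/-! ### Lower bounds for the spread -/

section Spread

variable {U J : Type*} [Fintype U] [Fintype J]

theorem two_mul_totalSpread (a : U → J → ℂ) :
    2 * totalSpread a = ∑ u, ∑ v, ∑ j, ‖a u j - a v j‖ ^ 2 := by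
  rw [totalSpread, Finset.mul_sum]
  simp only [← sum_norm_sub_sq]
  rw [Finset.sum_comm]
  exact Finset.sum_congr rfl fun u _ => Finset.sum_comm

theorem totalSpread_nonneg (a : U → J → ℂ) : 0 ≤ totalSpread a := by
  have h : 0 ≤ 2 * totalSpread a := by
    rw [two_mul_totalSpread]; positivity
  linarith

theorem totalSpread_sub_const (a : U → J → ℂ) (b : J → ℂ) :
    totalSpread (fun u => a u - b) = totalSpread a := by
  have h : 2 * totalSpread (fun u => a u - b) = 2 * totalSpread a := by
    simp [two_mul_totalSpread]
  linarith

/-- Split U into the fibre T of one value and its complement. Every pair across the split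
contributes at least |J|, and there are |T||Tᶜ| ≥ |U| - 1 such pairs. -/
theorem card_sub_one_mul_le_totalSpread {S : AddSubgroup (J → ℂ)}
    (hS : ∀ D ∈ S, D ≠ 0 → (Fintype.card J : ℝ) ≤ ∑ j, ‖D j‖ ^ 2) {a : U → J → ℂ}
    (ha : ∀ u, a u ∈ S) {u₀ u₁ : U} (h : a u₀ ≠ a u₁) :
    ((Fintype.card U : ℝ) - 1) * Fintype.card J ≤ totalSpread a := by
  classical
  let T : Finset U := {u | a u = a u₀}
  have hT : (1 : ℝ) ≤ T.card := by
    exact_mod_cast Finset.card_pos.mpr ⟨u₀, by simp [T]⟩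
  have hT' : (1 : ℝ) ≤ Tᶜ.card := by
    exact_mod_cast Finset.card_pos.mpr ⟨u₁, by simpa [T] using h.symm⟩
  have hsum : (T.card : ℝ) + Tᶜ.card = Fintype.card U := by
    exact_mod_cast Finset.card_add_card_compl T
  have key : ∀ u v, (Fintype.card J : ℝ) * ((if u ∈ T then 1 else 0) * (if v ∈ Tᶜ then 1 else 0)
      + (if u ∈ Tᶜ then 1 else 0) * (if v ∈ T then 1 else 0)) ≤
      ∑ j, ‖a u j - a v j‖ ^ 2 := by
    intro u v
    by_cases huv : a u = a v
    · have : u ∈ T ↔ v ∈ T := by simp [T, huv]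
      have h0 : 0 ≤ ∑ j, ‖a u j - a v j‖ ^ 2 := by positivity
      by_cases hv : v ∈ T <;> simpa [this, hv] using h0
    · have h1 := hS (a u - a v) (S.sub_mem (ha u) (ha v)) (sub_ne_zero.mpr huv)
      have h0 : 0 ≤ ∑ j, ‖a u j - a v j‖ ^ 2 := by positivity
      by_cases hu : u ∈ T <;> by_cases hv : v ∈ T <;> simp [hu, hv] <;>
        first | exact h0 | simpa using h1
  have hle := Finset.sum_le_sum fun u (_ : u ∈ Finset.univ) =>
    Finset.sum_le_sum fun v (_ : v ∈ Finset.univ) => key u v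
  rw [← two_mul_totalSpread] at hle
  simp only [← Finset.mul_sum, Finset.sum_add_distrib, ← Finset.sum_mul, Finset.sum_ite_mem,
    Finset.univ_inter, Finset.sum_const, nsmul_eq_mul, mul_one] at hle
  have hJ : (0 : ℝ) ≤ Fintype.card J := by positivity
  rw [← hsum]
  -- This is (|T| - 1)(|Tᶜ| - 1) ≥ 0.
  nlinarith [mul_nonneg hJ (mul_nonneg (sub_nonneg.mpr hT) (sub_nonneg.mpr hT'))]

/-- Once the mean `b` lies in `S`, the deviations from it lie in `S` and sum to zero, so a single
one cannot be nonzero alone. After centring, the spread is |U| times the sum of their squared norms.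
-/
theorem two_mul_card_mul_le_totalSpread {S : AddSubgroup (J → ℂ)}
    (hS : ∀ D ∈ S, D ≠ 0 → (Fintype.card J : ℝ) ≤ ∑ j, ‖D j‖ ^ 2) {a : U → J → ℂ}
    (ha : ∀ u, a u ∈ S) {u₀ u₁ : U} (h : a u₀ ≠ a u₁) {b : J → ℂ} (hb : b ∈ S)
    (hab : ∑ u, a u = Fintype.card U • b) :
    2 * Fintype.card U * Fintype.card J ≤ totalSpread a := by
  classical
  have hsum : ∑ u, (a u - b) = 0 := by
    rw [Finset.sum_sub_distrib, hab]; simp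
  obtain ⟨v, hv⟩ : ∃ v, a v - b ≠ 0 := by
    by_contra! hc
    exact h (by rw [sub_eq_zero.mp (hc u₀), sub_eq_zero.mp (hc u₁)])
  obtain ⟨w, hwv, hw⟩ : ∃ w, w ≠ v ∧ a w - b ≠ 0 := by
    by_contra! hc
    rw [Finset.sum_eq_single v (fun u _ hu => hc u hu) (by simp)] at hsum
    exact hv hsum
  rw [← totalSpread_sub_const a b, totalSpread]
  have h0 : ∀ j, ∑ u, (a u - b) j = 0 := fun j => by
    rw [← Finset.sum_apply, hsum, Pi.zero_apply]
  simp only [h0, norm_zero, ne_eq, OfNat.ofNat_ne_zero, not_false_eq_true, zero_pow, sub_zero]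
  rw [← Finset.mul_sum, Finset.sum_comm, mul_comm (2 : ℝ), mul_assoc]
  refine mul_le_mul_of_nonneg_left ?_ (Nat.cast_nonneg _)
  calc (2 : ℝ) * Fintype.card J ≤ ∑ u ∈ {v, w}, ∑ j, ‖(a u - b) j‖ ^ 2 := by
        rw [Finset.sum_pair hwv.symm, two_mul]
        exact add_le_add (hS _ (S.sub_mem (ha v) hb) hv) (hS _ (S.sub_mem (ha w) hb) hw)
    _ ≤ _ := Finset.sum_le_sum_of_subset_of_nonneg (Finset.subset_univ _)
        fun _ _ _ => by positivity

theorem two_mul_card_sub_one_mul_le_sum_totalSpread {T : Type*} [Fintype T]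
    {S : AddSubgroup (J → ℂ)}
    (hS : ∀ D ∈ S, D ≠ 0 → (Fintype.card J : ℝ) ≤ ∑ j, ‖D j‖ ^ 2) {a : T → U → J → ℂ}
    (ha : ∀ t u, a t u ∈ S) {t₀ : T} {u₀ u₁ : U} (h : a t₀ u₀ ≠ a t₀ u₁) {b : J → ℂ} (hb : b ∈ S)
    (hab : ∑ t, ∑ u, a t u = Fintype.card U • b) :
    2 * ((Fintype.card U : ℝ) - 1) * Fintype.card J ≤ ∑ t, totalSpread (a t) := by
  classical
  by_cases hc : ∃ t₁, t₁ ≠ t₀ ∧ ∃ v w, a t₁ v ≠ a t₁ w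
  · obtain ⟨t₁, ht, v, w, hvw⟩ := hc
    calc 2 * ((Fintype.card U : ℝ) - 1) * Fintype.card J ≤
        ∑ t ∈ {t₀, t₁}, totalSpread (a t) := by
          rw [Finset.sum_pair ht.symm]
          linarith [card_sub_one_mul_le_totalSpread hS (ha t₀) h,
            card_sub_one_mul_le_totalSpread hS (ha t₁) hvw]
      _ ≤ _ := Finset.sum_le_sum_of_subset_of_nonneg (Finset.subset_univ _)
        fun _ _ _ => totalSpread_nonneg _
  -- Every other family is constant, so its sum is |U| times an element of `S`; subtracting these
  -- from `hab` puts the mean of the remaining family in `S`.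
  · push Not at hc
    have hsum : ∑ u, a t₀ u =
        Fintype.card U • (b - ∑ t ∈ Finset.univ.erase t₀, a t u₀) := by
      rw [smul_sub, ← hab, Finset.smul_sum, eq_sub_iff_add_eq,
        ← Finset.add_sum_erase _ _ (Finset.mem_univ t₀)]
      congr 1
      refine Finset.sum_congr rfl fun t ht => ?_
      rw [Finset.sum_congr rfl fun u _ => hc t (Finset.ne_of_mem_erase ht) u u₀]
      simp
    have h1 := two_mul_card_mul_le_totalSpread hS (ha t₀) h
      (S.sub_mem hb (S.sum_mem fun t _ => ha t u₀)) hsum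
    have h2 := Finset.single_le_sum (f := fun t => totalSpread (a t))
      (fun t _ => totalSpread_nonneg _) (Finset.mem_univ t₀)
    have hJ : (0 : ℝ) ≤ Fintype.card J := by positivity
    linarith

end Spread

/-! ### Summation over units modulo a prime power -/

theorem sum_units_prime_pow {p Q : ℕ} (hp : p.Prime) {m : ℕ} (hQ : Q = p ^ m) (f : ℕ → ℝ)
    [NeZero (Q * p)] :
    ∑ i : (ZMod (Q * p))ˣ, f (i : ZMod (Q * p)).val =
      ∑ l : Fin Q, ∑ i : Fin p, f (i + p * l) - ∑ l : Fin Q, f (p * l) := by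
  have hcop : ∀ k : ℕ, k.Coprime (Q * p) ↔ ¬ p ∣ k := by
    intro k
    rw [hQ, ← pow_succ, Nat.coprime_pow_right_iff (Nat.succ_pos m), Nat.coprime_comm,
      hp.coprime_iff_not_dvd]
  have h1 : ∑ i : (ZMod (Q * p))ˣ, f (i : ZMod (Q * p)).val =
      ∑ k ∈ Finset.range (Q * p), if p ∣ k then 0 else f k := by
    have hite : ∀ k, (if p ∣ k then 0 else f k) = if ¬ p ∣ k then f k else 0 := fun k => by
      rw [ite_not]
    simp only [hite, ← Finset.sum_filter]
    refine Finset.sum_bij (fun i _ => (i : ZMod (Q * p)).val) ?_ ?_ ?_ fun _ _ => rfl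
    · intro i _
      rw [Finset.mem_filter, Finset.mem_range, ← hcop]
      exact ⟨ZMod.val_lt _, ZMod.val_coe_unit_coprime i⟩
    · intro i _ j _ hij
      exact Units.ext (ZMod.val_injective _ hij)
    · intro k hk
      rw [Finset.mem_filter, Finset.mem_range, ← hcop] at hk
      exact ⟨ZMod.unitOfCoprime k hk.2, Finset.mem_univ _, by simp [ZMod.val_natCast_of_lt hk.1]⟩
  have : NeZero p := ⟨hp.ne_zero⟩
  rw [h1, ← Fin.sum_univ_eq_sum_range (fun k => if p ∣ k then 0 else f k),
    ← finProdFinEquiv.sum_comp, Fintype.sum_prod_type, ← Finset.sum_sub_distrib]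
  refine Finset.sum_congr rfl fun l _ => ?_
  simp only [finProdFinEquiv_apply_val]
  rw [← Finset.add_sum_erase _ _ (Finset.mem_univ (0 : Fin p)),
    ← Finset.add_sum_erase _ _ (Finset.mem_univ (0 : Fin p))]
  simp only [Fin.val_zero, zero_add, dvd_mul_right, if_true, add_sub_cancel_left]
  refine Finset.sum_congr rfl fun i hi => ?_
  rw [if_neg]
  rw [Nat.dvd_add_left (dvd_mul_right _ _)]
  intro hd
  exact Finset.ne_of_mem_erase hi (Fin.ext (by simpa using Nat.eq_zero_of_dvd_of_lt hd i.2))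

/-- Write residues as i + pl, remove those with i = 0, and apply Parseval first in l, then in i. The
removed terms produce the subtracted squares. -/
theorem sum_units_norm_sq {p Q : ℕ} (hp : p.Prime) {m : ℕ} (hQ : Q = p ^ m) [NeZero (Q * p)]
    {ω : ℂ} (hω : IsPrimitiveRoot ω (Q * p)) (a : Fin Q → Fin p → ℂ) :
    ∑ i : (ZMod (Q * p))ˣ, ‖∑ t, ∑ u, a t u * ω ^ ((i : ZMod (Q * p)).val * (t + Q * u))‖ ^ 2 =
      Q * ∑ t, (p * ∑ u, ‖a t u‖ ^ 2 - ‖∑ u, a t u‖ ^ 2) := by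
  have hpos : 0 < Q * p := NeZero.pos _
  have hωp : IsPrimitiveRoot (ω ^ p) Q := hω.pow hpos (mul_comm Q p)
  have hωQ : IsPrimitiveRoot (ω ^ Q) p := hω.pow hpos rfl
  rw [sum_units_prime_pow hp hQ
    (fun k => ‖∑ t, ∑ u, a t u * ω ^ (k * (t + Q * u))‖ ^ 2)]
  have hexp : ∀ (i : ℕ) (l : Fin Q),
      ∑ t : Fin Q, ∑ u : Fin p, a t u * ω ^ ((i + p * l) * (t + Q * u)) =
      ∑ t : Fin Q, ((∑ u : Fin p, a t u * (ω ^ Q) ^ (i * u)) * ω ^ (i * t)) *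
        (ω ^ p) ^ ((l : ℕ) * t) := by
    intro i l
    refine Finset.sum_congr rfl fun t _ => ?_
    rw [Finset.sum_mul, Finset.sum_mul]
    refine Finset.sum_congr rfl fun u _ => ?_
    -- The cross term p·l·Q·u drops out because ω has order Qp.
    have : ω ^ ((i + p * l) * (t + Q * u)) =
        (ω ^ Q) ^ (i * u) * ω ^ (i * t) * (ω ^ p) ^ ((l : ℕ) * t) *
          (ω ^ (Q * p)) ^ ((l : ℕ) * u) := by
      simp only [← pow_mul, ← pow_add]; congr 1; ring
    rw [this, hω.pow_eq_one]; ring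
  have hnorm : ∀ k, ‖ω ^ k‖ = 1 := fun k => by
    rw [norm_pow, hω.norm'_eq_one hpos.ne', one_pow]
  have hpars : ∀ i : ℕ, ∑ l : Fin Q, ‖∑ t, ∑ u, a t u * ω ^ ((i + p * l) * (t + Q * u))‖ ^ 2 =
      Q * ∑ t, ‖∑ u : Fin p, a t u * (ω ^ Q) ^ (i * u)‖ ^ 2 := by
    intro i
    simp only [hexp]
    rw [sum_norm_sq_sum_mul_pow hωp]
    simp only [norm_mul, hnorm, mul_one]
  rw [Finset.sum_comm]
  simp only [hpars]
  have h0 := hpars 0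
  simp only [zero_add, zero_mul, pow_zero, mul_one] at h0
  rw [h0, ← Finset.mul_sum, Finset.sum_comm]
  simp only [sum_norm_sq_sum_mul_pow hωQ]
  rw [← mul_sub, ← Finset.sum_sub_distrib]

theorem two_mul_card_units_le_sum_norm_sq {p Q m n : ℕ} (hp : p.Prime) (hQ : Q = p ^ m)
    [NeZero (Q * p)] [NeZero n] {ω η : ℂ} (hω : IsPrimitiveRoot ω (Q * p))
    (hη : IsPrimitiveRoot η n) (a : Fin Q → Fin p → (ZMod n)ˣ → ℂ)
    (ha : ∀ t u, a t u ∈ conjugateValues n η) {b : (ZMod n)ˣ → ℂ} (hb : b ∈ conjugateValues n η)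
    (hab : ∑ t, ∑ u, a t u = p • b)
    (h0 : ∃ (i : (ZMod (Q * p))ˣ) (j : (ZMod n)ˣ),
      ∑ t, ∑ u, a t u j * ω ^ ((i : ZMod (Q * p)).val * (t + Q * u)) ≠ 0) :
    2 * (Fintype.card (ZMod (Q * p))ˣ : ℝ) * Fintype.card (ZMod n)ˣ ≤
      ∑ i : (ZMod (Q * p))ˣ, ∑ j : (ZMod n)ˣ,
        ‖∑ t, ∑ u, a t u j * ω ^ ((i : ZMod (Q * p)).val * (t + Q * u))‖ ^ 2 := by
  have hcard : (Fintype.card (ZMod (Q * p))ˣ : ℝ) = Q * (p - 1) := by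
    have h := Nat.totient_prime_pow_succ hp m
    rw [ZMod.card_units_eq_totient, hQ, ← pow_succ, h, Nat.cast_mul, Nat.cast_pred hp.pos]
  -- If every coset were constant, the spread and hence every value would vanish, against `h0`.
  have hex : ∃ t u v, a t u ≠ a t v := by
    by_contra! hc
    obtain ⟨i, j, hij⟩ := h0
    have := sum_units_norm_sq hp hQ hω fun t u => a t u j
    have h2 : ∀ t, (p : ℝ) * ∑ u, ‖a t u j‖ ^ 2 - ‖∑ u, a t u j‖ ^ 2 = 0 := by
      intro t
      have : ∀ u, a t u j = a t ⟨0, hp.pos⟩ j := fun u => by rw [hc]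
      simp only [this, Finset.sum_const, Finset.card_univ, Fintype.card_fin, nsmul_eq_mul,
        norm_mul, Complex.norm_natCast]
      ring
    simp only [h2, Finset.sum_const_zero, mul_zero] at this
    rw [Finset.sum_eq_zero_iff_of_nonneg fun _ _ => by positivity] at this
    have := this i (Finset.mem_univ _)
    simp only [ne_eq, OfNat.ofNat_ne_zero, not_false_eq_true, pow_eq_zero_iff,
      norm_eq_zero] at this
    exact hij this
  obtain ⟨t, u, v, h⟩ := hex
  have key := two_mul_card_sub_one_mul_le_sum_totalSpread
    (fun D hD => card_le_sum_norm_sq_of_mem_conjugateValues hη hD) ha h hb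
    (by rw [hab, Fintype.card_fin])
  rw [Finset.sum_comm]
  simp only [fun j => sum_units_norm_sq hp hQ hω fun t u => a t u j]
  rw [← Finset.mul_sum, Finset.sum_comm, hcard]
  simp only [totalSpread, Fintype.card_fin] at key
  have := mul_le_mul_of_nonneg_left key (Nat.cast_nonneg Q)
  linarith

/-! ### Eigenspaces and traces of operators of finite order -/

open Module.End in
theorem isInternal_eigenspace_of_pow_eq_one {V ι : Type*} [AddCommGroup V] [Module ℂ V]
    [FiniteDimensional ℂ V] [DecidableEq ι] {T : Module.End ℂ V} {N : ℕ} (hN : N ≠ 0)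
    (hT : T ^ N = 1) {e : ι → ℂ} (he : Function.Injective e)
    (hs : ∀ z : ℂ, z ^ N = 1 → z ∈ Set.range e) :
    DirectSum.IsInternal fun i => T.eigenspace (e i) := by
  rw [DirectSum.isInternal_submodule_iff_iSupIndep_and_iSup_eq_top]
  refine ⟨T.eigenspaces_iSupIndep.comp he, ?_⟩
  have hss : T.IsSemisimple := by
    refine Module.End.isSemisimple_of_squarefree_aeval_eq_zero
      (p := Polynomial.X ^ N - 1) ?_ (by simp [hT])
    exact (Polynomial.separable_X_pow_sub_C (1 : ℂ) (by exact_mod_cast hN) one_ne_zero).squarefree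
  rw [eq_top_iff, ← hss.iSup_eigenspace_eq_top, iSup_le_iff]
  intro μ v hv
  by_cases hv0 : v = 0
  · simp [hv0]
  have hμ : μ ^ N = 1 := by
    have h : (T ^ N) v = μ ^ N • v := HasEigenvector.pow_apply ⟨hv, hv0⟩ N
    rw [hT, Module.End.one_apply] at h
    by_contra hne
    refine hv0 ((smul_eq_zero.mp (?_ : (μ ^ N - 1) • v = 0)).resolve_left (sub_ne_zero.mpr hne))
    rw [sub_smul, ← h, one_smul, sub_self]
  obtain ⟨i, rfl⟩ := hs μ hμ
  exact Submodule.mem_iSup_of_mem (p := fun i => T.eigenspace (e i)) i hv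

theorem mapsTo_eigenspace_of_commute {V : Type*} [AddCommGroup V] [Module ℂ V]
    {S T : Module.End ℂ V} (h : Commute T S) (μ : ℂ) :
    ∀ v ∈ T.eigenspace μ, S v ∈ T.eigenspace μ := by
  intro v hv
  rw [Module.End.mem_eigenspace_iff] at hv ⊢
  rw [← Module.End.mul_apply, h.eq, Module.End.mul_apply, hv, map_smul]

theorem trace_mul_pow_eq_sum {V ι : Type*} [AddCommGroup V] [Module ℂ V]
    [FiniteDimensional ℂ V] [Fintype ι] {S T : Module.End ℂ V} {N : ℕ} (hN : N ≠ 0)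
    (hT : T ^ N = 1) {e : ι → ℂ} (he : Function.Injective e)
    (hs : ∀ z : ℂ, z ^ N = 1 → z ∈ Set.range e) (h : Commute T S) (k : ℕ) :
    LinearMap.trace ℂ V (S * T ^ k) = ∑ i, LinearMap.trace ℂ (T.eigenspace (e i))
      (S.restrict (mapsTo_eigenspace_of_commute h (e i))) * e i ^ k := by
  classical
  have hc : Commute T (S * T ^ k) := h.mul_right (Commute.self_pow T k)
  rw [LinearMap.trace_eq_sum_trace_restrict (isInternal_eigenspace_of_pow_eq_one hN hT he hs)
    fun i => mapsTo_eigenspace_of_commute hc (e i)]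
  refine Finset.sum_congr rfl fun i _ => ?_
  refine Eq.trans (congrArg _ ?_) ((map_smul (LinearMap.trace ℂ _) (e i ^ k)
    (S.restrict (mapsTo_eigenspace_of_commute h (e i)))).trans (mul_comm _ _))
  ext ⟨v, hv⟩
  have hk : (T ^ k) v = e i ^ k • v := by
    by_cases hv0 : v = 0
    · simp [hv0]
    · exact Module.End.HasEigenvector.pow_apply ⟨hv, hv0⟩ k
  simp [LinearMap.restrict_apply, hk]

theorem trace_pow_eq_sum {V ι : Type*} [AddCommGroup V] [Module ℂ V]
    [FiniteDimensional ℂ V] [Fintype ι] {T : Module.End ℂ V} {N : ℕ} (hN : N ≠ 0)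
    (hT : T ^ N = 1) {e : ι → ℂ} (he : Function.Injective e)
    (hs : ∀ z : ℂ, z ^ N = 1 → z ∈ Set.range e) (k : ℕ) :
    LinearMap.trace ℂ V (T ^ k) =
      ∑ i, (Module.finrank ℂ (T.eigenspace (e i)) : ℂ) * e i ^ k := by
  have h := trace_mul_pow_eq_sum hN hT he hs (Commute.one_right T) k
  rw [one_mul] at h
  rw [h]
  refine Finset.sum_congr rfl fun i _ => ?_
  rw [← LinearMap.trace_one]
  rfl

theorem IsPrimitiveRoot.injective_pow_fin {ζ : ℂ} {N : ℕ} (hζ : IsPrimitiveRoot ζ N) :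
    Function.Injective fun i : Fin N => ζ ^ (i : ℕ) :=
  fun i j hij => Fin.ext (hζ.pow_inj i.2 j.2 hij)

theorem IsPrimitiveRoot.mem_range_pow_fin {ζ : ℂ} {N : ℕ} [NeZero N] (hζ : IsPrimitiveRoot ζ N)
    (z : ℂ) (hz : z ^ N = 1) : z ∈ Set.range fun i : Fin N => ζ ^ (i : ℕ) := by
  obtain ⟨i, hi, rfl⟩ := hζ.eq_pow_of_pow_eq_one hz
  exact ⟨⟨i, hi⟩, rfl⟩

/-- Taking determinants and cancelling gives z^(dim W) = 1. -/
theorem IsPrimitiveRoot.dvd_finrank_of_commutator_eq_smul {W : Type*} [AddCommGroup W] [Module ℂ W]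
    {H X : Module.End ℂ W} (hH : IsUnit H) (hX : IsUnit X) {z : ℂ} {p : ℕ}
    (hz : IsPrimitiveRoot z p) (h : H * X = z • (X * H)) : p ∣ Module.finrank ℂ W := by
  apply hz.dvd_of_pow_eq_one
  have hdet := congrArg LinearMap.det h
  rw [LinearMap.det_smul, map_mul, map_mul, mul_comm (LinearMap.det X)] at hdet
  have hne : LinearMap.det H * LinearMap.det X ≠ 0 :=
    mul_ne_zero (hH.map LinearMap.det).ne_zero (hX.map LinearMap.det).ne_zero
  exact (mul_right_cancel₀ hne (by rw [one_mul]; exact hdet)).symm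

theorem trace_eq_star_trace_of_mul_eq_one {V : Type*} [AddCommGroup V] [Module ℂ V] [FiniteDimensional ℂ V]
    {T T' : Module.End ℂ V} {N : ℕ} (hN : N ≠ 0) (hT : T ^ N = 1) (hTT' : T * T' = 1) :
    LinearMap.trace ℂ V T' = (starRingEnd ℂ) (LinearMap.trace ℂ V T) := by
  have : NeZero N := ⟨hN⟩
  have hζ := Complex.isPrimitiveRoot_exp N hN
  obtain ⟨k, rfl⟩ : ∃ k, N = k + 1 := ⟨N - 1, by omega⟩
  have hT' : T' = T ^ k := by
    rw [← mul_one (T ^ k), ← hTT', ← mul_assoc, ← pow_succ, hT, one_mul]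
  have h1 := trace_pow_eq_sum hN hT hζ.injective_pow_fin hζ.mem_range_pow_fin 1
  rw [pow_one] at h1
  rw [hT', h1, trace_pow_eq_sum hN hT hζ.injective_pow_fin hζ.mem_range_pow_fin k, map_sum]
  refine Finset.sum_congr rfl fun i _ => ?_
  rw [map_mul, pow_one, Complex.conj_natCast]
  congr 1
  set w := Complex.exp (2 * Real.pi * Complex.I / (k + 1 : ℕ)) ^ (i : ℕ) with hw
  have hw1 : w ^ (k + 1) = 1 := by rw [hw, pow_right_comm, hζ.pow_eq_one, one_pow]
  have hnorm : ‖w‖ = 1 := Complex.norm_eq_one_of_pow_eq_one hw1 hN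
  have hw0 : w ≠ 0 := by intro h; simp [h] at hnorm
  refine mul_right_cancel₀ hw0 ?_
  rw [← pow_succ, hw1, mul_comm, Complex.mul_conj', hnorm]
  simp

/-! ### The Galois average for one representation -/

section FiniteGroup

variable {G : Type*} [Group G]

theorem Representation.character_inv [Finite G] {V : Type*} [AddCommGroup V] [Module ℂ V]
    [FiniteDimensional ℂ V] (ρ : Representation ℂ G V) (g : G) :
    ρ.character g⁻¹ = (starRingEnd ℂ) (ρ.character g) :=
  trace_eq_star_trace_of_mul_eq_one (Nat.card_pos (α := G)).ne' (by rw [← map_pow, pow_card_eq_one', map_one])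
    (by rw [← map_mul, mul_inv_cancel, map_one])

theorem dvd_finrank_eigenspace {V : Type*} [AddCommGroup V] [Module ℂ V]
    (ρ : Representation ℂ G V) {b h x : G} (hh : Commute b h) (hx : Commute b x) {z : ℂ} {p : ℕ}
    (hz : IsPrimitiveRoot z p) (hhx : ρ h * ρ x = z • (ρ x * ρ h)) (μ : ℂ) :
    p ∣ Module.finrank ℂ (Module.End.eigenspace (ρ b) μ) := by
  have hmap (y : G) (hy : Commute b y) := mapsTo_eigenspace_of_commute (hy.map ρ) μ
  have hunit (y : G) (hy : Commute b y) : IsUnit ((ρ y).restrict (hmap y hy)) := by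
    refine ⟨⟨_, (ρ y⁻¹).restrict (hmap y⁻¹ hy.inv_right), ?_, ?_⟩, rfl⟩ <;>
    · ext v; simp [LinearMap.restrict_apply]
  refine hz.dvd_finrank_of_commutator_eq_smul (hunit h hh) (hunit x hx) ?_
  ext v
  simpa [LinearMap.restrict_apply] using LinearMap.congr_fun hhx (v : V)

theorem two_mul_card_units_le_sum_character_norm_sq {V : Type*} [AddCommGroup V] [Module ℂ V]
    [FiniteDimensional ℂ V] (ρ : Representation ℂ G V) {p Q m n : ℕ} (hp : p.Prime)
    (hQ : Q = p ^ m) [NeZero (Q * p)] [NeZero n] {a b h x : G} (hab : Commute a b)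
    (ha : a ^ (Q * p) = 1) (hb : b ^ n = 1)
    (hh : Commute b h) (hx : Commute b x) {z : ℂ}
    (hz : IsPrimitiveRoot z p) (hhx : ρ h * ρ x = z • (ρ x * ρ h))
    (h0 : ∃ (i : (ZMod (Q * p))ˣ) (j : (ZMod n)ˣ),
      ρ.character (a ^ (i : ZMod (Q * p)).val * b ^ (j : ZMod n).val) ≠ 0) :
    2 * (Fintype.card (ZMod (Q * p))ˣ : ℝ) * Fintype.card (ZMod n)ˣ ≤
      ∑ i : (ZMod (Q * p))ˣ, ∑ j : (ZMod n)ˣ,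
        ‖ρ.character (a ^ (i : ZMod (Q * p)).val * b ^ (j : ZMod n).val)‖ ^ 2 := by
  have hω := Complex.isPrimitiveRoot_exp (Q * p) (NeZero.ne _)
  have hη := Complex.isPrimitiveRoot_exp n (NeZero.ne _)
  set ω := Complex.exp (2 * Real.pi * Complex.I / (Q * p : ℕ))
  set η := Complex.exp (2 * Real.pi * Complex.I / (n : ℕ))
  -- Exponents are written as t + Qu, so that fixing t gives a coset of the multiples of Q.
  let ix : Fin Q × Fin p ≃ Fin (Q * p) :=
    (Equiv.prodComm _ _).trans (finProdFinEquiv.trans (finCongr (mul_comm p Q)))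
  have hix : ∀ t u, ((ix (t, u) : Fin (Q * p)) : ℕ) = t + Q * u := fun t u => by
    simp [ix]
  let e : Fin Q × Fin p → ℂ := fun r => ω ^ ((ix r : Fin (Q * p)) : ℕ)
  have he : Function.Injective e := hω.injective_pow_fin.comp ix.injective
  have hs : ∀ w : ℂ, w ^ (Q * p) = 1 → w ∈ Set.range e := fun w hw => by
    obtain ⟨i, hi⟩ := hω.mem_range_pow_fin w hw
    exact ⟨ix.symm i, by simpa [e] using hi⟩
  have hTa : ρ a ^ (Q * p) = 1 := by rw [← map_pow, ha, map_one]
  have hTb : ρ b ^ n = 1 := by rw [← map_pow, hb, map_one]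
  have hc : Commute (ρ a) (ρ b) := hab.map ρ
  let Tb (r : Fin Q × Fin p) : Module.End ℂ (Module.End.eigenspace (ρ a) (e r)) :=
    (ρ b).restrict (mapsTo_eigenspace_of_commute hc (e r))
  have hTbn (r) : Tb r ^ n = 1 := by
    rw [Module.End.pow_restrict]
    ext v
    simp [LinearMap.restrict_apply, hTb]
  let A (t : Fin Q) (u : Fin p) (j : (ZMod n)ˣ) : ℂ :=
    LinearMap.trace ℂ _ (Tb (t, u) ^ (j : ZMod n).val)
  let d (s : Fin n) : ℕ := Module.finrank ℂ (Module.End.eigenspace (ρ b) (η ^ (s : ℕ)))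
  have hd (s : Fin n) : p ∣ d s := dvd_finrank_eigenspace ρ hh hx hz hhx _
  -- This is χ(b^j)/p, integral because p divides every multiplicity `d s`.
  let B (j : (ZMod n)ˣ) : ℂ :=
    ∑ s : Fin n, ((d s / p : ℕ) : ℤ) * (η ^ (j : ZMod n).val) ^ (s : ℕ)
  have hχ : ∀ (i k : ℕ), ρ.character (a ^ i * b ^ k) =
      ∑ t, ∑ u, LinearMap.trace ℂ _ (Tb (t, u) ^ k) * ω ^ (i * (t + Q * u)) := by
    intro i k
    rw [Representation.character, ← (hab.pow_pow i k).eq.symm, map_mul, map_pow, map_pow,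
      trace_mul_pow_eq_sum (NeZero.ne _) hTa he hs (hc.pow_right k) i, Fintype.sum_prod_type]
    refine Finset.sum_congr rfl fun t _ => Finset.sum_congr rfl fun u _ => ?_
    rw [Module.End.pow_restrict]
    congr 1
    simp only [e, hix]
    rw [← pow_mul, mul_comm i]
  have hA : ∀ t u, A t u ∈ conjugateValues n η := by
    intro t u
    have := sum_pow_mem_conjugateValues (n := n) (η := η) Finset.univ
      (fun s : Fin n => (Module.finrank ℂ ((Tb (t, u)).eigenspace (η ^ (s : ℕ))) : ℤ))
      (fun s => (s : ℕ))
    convert this using 2 with j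
    simp only [A]
    rw [trace_pow_eq_sum (NeZero.ne n) (hTbn (t, u)) hη.injective_pow_fin hη.mem_range_pow_fin]
    refine Finset.sum_congr rfl fun s _ => ?_
    rw [pow_right_comm]
    simp
  have hB : B ∈ conjugateValues n η := sum_pow_mem_conjugateValues _ _ _
  have hAB : ∑ t, ∑ u, A t u = p • B := by
    ext j
    have h1 := hχ 0 (j : ZMod n).val
    simp only [pow_zero, one_mul, zero_mul, mul_one] at h1
    simp only [Finset.sum_apply, A, Pi.smul_apply]
    rw [← h1, Representation.character, map_pow, trace_pow_eq_sum (NeZero.ne n) hTb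
      hη.injective_pow_fin hη.mem_range_pow_fin, nsmul_eq_mul, Finset.mul_sum]
    refine Finset.sum_congr rfl fun s _ => ?_
    rw [pow_right_comm, ← mul_assoc]
    congr 1
    rw [Int.cast_natCast, ← Nat.cast_mul, Nat.mul_div_cancel' (hd s)]
  have key := two_mul_card_units_le_sum_norm_sq hp hQ hω hη A hA hB hAB
  simp only [hχ] at h0 ⊢
  exact key h0

/-! ### Schur's lemma, completeness of characters, column orthogonality -/

theorem Representation.IsIrreducible.exists_eq_smul_one {V : Type*} [AddCommGroup V] [Module ℂ V]
    [FiniteDimensional ℂ V] {ρ : Representation ℂ G V} (hρ : ρ.IsIrreducible)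
    {T : Module.End ℂ V} (hT : ∀ g, T * ρ g = ρ g * T) : ∃ c : ℂ, T = c • 1 := by
  let f : Representation.IntertwiningMap ρ ρ := ⟨T, hT⟩
  obtain ⟨c, hc⟩ :=
    (Representation.IsIrreducible.algebraMap_intertwiningMap_bijective_of_isAlgClosed (ρ := ρ)).2 f
  exact ⟨c, (congrArg Representation.IntertwiningMap.toLinearMap hc).symm⟩

theorem Representation.character_mem_Irr {V : Type*} [AddCommGroup V] [Module ℂ V]
    [FiniteDimensional ℂ V] {ρ : Representation ℂ G V} (hρ : ρ.IsIrreducible) :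
    ρ.character ∈ Irr G := by
  let e : V ≃ₗ[ℂ] (Fin (Module.finrank ℂ V) → ℂ) := LinearEquiv.ofFinrankEq _ _ (by simp)
  let σ : Representation ℂ G (Fin (Module.finrank ℂ V) → ℂ) :=
    (e.conjAlgEquiv ℂ : _ →* _).comp ρ
  have hσ (g : G) (v) : σ g (e v) = e (ρ g v) := by
    simp [σ, LinearEquiv.conjAlgEquiv_apply]
  refine ⟨_, _, _, inferInstance, σ, ?_, ?_⟩
  · let E : Subrepresentation ρ ≃o Subrepresentation σ :=
      { toFun := fun W => ⟨W.toSubmodule.map e.toLinearMap, fun g v hv => by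
          obtain ⟨w, hw, rfl⟩ := hv
          exact ⟨ρ g w, W.apply_mem_toSubmodule g hw, (hσ g w).symm⟩⟩
        invFun := fun W => ⟨W.toSubmodule.comap e.toLinearMap, fun g v hv => by
          have := W.apply_mem_toSubmodule g hv
          rw [LinearEquiv.coe_coe, hσ] at this
          exact this⟩
        left_inv := fun W => Subrepresentation.toSubmodule_injective
          (Submodule.comap_map_eq_of_injective e.injective _)
        right_inv := fun W => Subrepresentation.toSubmodule_injective
          (Submodule.map_comap_eq_of_surjective e.surjective _)
        map_rel_iff' := fun {W W'} => Submodule.map_le_map_iff_of_injective e.injective _ _ }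
    exact E.symm.isSimpleOrder_iff.mpr hρ
  · ext g
    exact LinearMap.trace_conj' (ρ g) e

/-- On an irreducible space the operator is a scalar by Schur, with trace zero by orthogonality.
Otherwise Maschke splits the space and induction on dimension applies. -/
theorem sum_smul_eq_zero_of_orthogonal [Fintype G] {f : G → ℂ} (hf : ∀ g x, f (g * x * g⁻¹) = f x)
    (h : ∀ χ ∈ Irr G, ∑ x, f x * χ x⁻¹ = 0) {V : Type*} [AddCommGroup V] [Module ℂ V]
    [FiniteDimensional ℂ V] (ρ : Representation ℂ G V) : ∑ x, f x • ρ x⁻¹ = 0 := by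
  induction hn : Module.finrank ℂ V using Nat.strong_induction_on generalizing V with
  | _ n ih =>
  by_cases hρ : ρ.IsIrreducible
  · have hcomm : ∀ g, (∑ x, f x • ρ x⁻¹) * ρ g = ρ g * ∑ x, f x • ρ x⁻¹ := by
      intro g
      rw [Finset.sum_mul, Finset.mul_sum, ← (MulAut.conj g).toEquiv.sum_comp]
      refine Finset.sum_congr rfl fun x _ => ?_
      simp only [MulEquiv.toEquiv_eq_coe, EquivLike.coe_coe, MulAut.conj_apply, hf,
        smul_mul_assoc, mul_smul_comm, ← map_mul]
      congr 2
      group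
    obtain ⟨c, hc⟩ := hρ.exists_eq_smul_one hcomm
    have htr := congrArg (LinearMap.trace ℂ V) hc
    rw [map_sum, map_smul, LinearMap.trace_one] at htr
    have h0 := h _ (Representation.character_mem_Irr hρ)
    simp only [map_smul, smul_eq_mul] at htr
    simp only [Representation.character] at h0
    rw [h0] at htr
    have : Nontrivial V := by
      by_contra hV
      rw [not_nontrivial_iff_subsingleton] at hV
      refine hρ.exists_pair_ne.elim fun W ⟨W', hW⟩ => hW ?_
      exact Subrepresentation.toSubmodule_injective (Subsingleton.elim _ _)
    rcases mul_eq_zero.mp htr.symm with h1 | h1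
    · rw [hc, h1, zero_smul]
    · exact absurd h1 (by exact_mod_cast Module.finrank_pos.ne')
  · have hNe : NeZero (Nat.card G : ℂ) := ⟨by exact_mod_cast Nat.card_pos.ne'⟩
    by_cases hV : Subsingleton V
    · exact LinearMap.ext fun v => Subsingleton.elim _ _
    rw [not_subsingleton_iff_nontrivial] at hV
    have hnt : Nontrivial (Subrepresentation ρ) := ⟨⊥, ⊤, fun hbt => by
      have := congrArg Subrepresentation.toSubmodule hbt
      exact bot_ne_top this⟩
    obtain ⟨W, hW⟩ : ∃ W : Subrepresentation ρ, ¬ (W = ⊥ ∨ W = ⊤) := by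
      by_contra! hc
      exact hρ ⟨fun W => hc W⟩
    push Not at hW
    obtain ⟨W', hWW'⟩ := exists_isCompl W
    have hzero : ∀ U : Subrepresentation ρ, U ≠ ⊤ → ∀ v ∈ U, (∑ x, f x • ρ x⁻¹) v = 0 := by
      intro U hU v hv
      have hlt : Module.finrank ℂ U.toSubmodule < n := by
        rw [← hn]
        refine Submodule.finrank_lt fun htop => hU ?_
        exact Subrepresentation.toSubmodule_injective htop
      have := congrArg Subtype.val (LinearMap.congr_fun (ih _ hlt U.toRepresentation rfl) ⟨v, hv⟩)
      simpa [LinearMap.sum_apply, Subrepresentation.toRepresentation] using this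
    have hW' : W' ≠ ⊤ := by
      rintro rfl
      exact hW.1 (by simpa using hWW'.inf_eq_bot)
    ext v
    have hv : v ∈ (W ⊔ W').toSubmodule := by
      rw [hWW'.sup_eq_top]; exact Submodule.mem_top
    rw [Subrepresentation.toSubmodule_sup] at hv
    obtain ⟨w, hw, w', hw', rfl⟩ := Submodule.mem_sup.mp hv
    rw [map_add, hzero W hW.2 w hw, hzero W' hW' w' hw']
    simp

theorem eq_zero_of_orthogonal_Irr [Fintype G] {f : G → ℂ} (hf : ∀ g x, f (g * x * g⁻¹) = f x)
    (h : ∀ χ ∈ Irr G, ∑ x, f x * χ x⁻¹ = 0) : f = 0 := by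
  classical
  let ρ : Representation ℂ G (G → ℂ) :=
    { toFun := fun g => LinearMap.funLeft ℂ ℂ fun x => g⁻¹ * x
      map_one' := by ext; simp [LinearMap.funLeft]
      map_mul' := fun a b => by
        ext v x
        simp [LinearMap.funLeft, mul_assoc] }
  have h0 := sum_smul_eq_zero_of_orthogonal hf h ρ
  ext y
  -- In the regular representation, the operator applied to the delta function at 1 recovers f.
  have := congrFun (LinearMap.congr_fun h0 (Pi.single 1 1)) y⁻¹
  simpa [ρ, LinearMap.funLeft, LinearMap.sum_apply, Pi.single_apply, mul_inv_eq_one] using this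

theorem sum_Irr_mul_inv [Fintype G] {χ ψ : G → ℂ} (hχ : χ ∈ Irr G) (hψ : ψ ∈ Irr G)
    [Decidable (χ = ψ)] :
    ∑ g, χ g * ψ g⁻¹ = if χ = ψ then (Nat.card G : ℂ) else 0 := by
  have hG : (Nat.card G : ℂ) ≠ 0 := by exact_mod_cast Nat.card_pos.ne'
  let _ : Invertible (Nat.card G : ℂ) := invertibleOfNonzero hG
  obtain ⟨V, _, _, _, ρ, hρ, rfl⟩ := hχ
  obtain ⟨W, _, _, _, σ, hσ, rfl⟩ := hψ
  split_ifs with hc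
  · have h := Representation.char_orthonormal ρ ρ
    rw [if_pos ⟨Representation.Equiv.refl ρ⟩, inv_mul_eq_iff_eq_mul₀ hG] at h
    rw [← hc]
    simpa using h
  · have h := Representation.char_orthonormal ρ σ
    rw [if_neg, inv_mul_eq_iff_eq_mul₀ hG] at h
    · simpa using h
    · rintro ⟨φ⟩
      exact hc (Representation.char_iso φ).symm

theorem Irr_apply_conj {χ : G → ℂ} (hχ : χ ∈ Irr G) (g x : G) : χ (g * x * g⁻¹) = χ x := by
  obtain ⟨V, _, _, _, ρ, hρ, rfl⟩ := hχ
  exact ρ.char_conj x g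

theorem card_mul_eq_sum_Irr [Fintype G] {I : Finset (G → ℂ)} (hI : ∀ χ, χ ∈ I ↔ χ ∈ Irr G)
    {f : G → ℂ} (hf : ∀ g x, f (g * x * g⁻¹) = f x) (y : G) :
    Nat.card G * f y = ∑ χ ∈ I, (∑ x, f x * χ x⁻¹) * χ y := by
  classical
  let F : G → ℂ := fun y => Nat.card G * f y - ∑ χ ∈ I, (∑ x, f x * χ x⁻¹) * χ y
  have hF : F = 0 := by
    refine eq_zero_of_orthogonal_Irr (fun g x => ?_) fun ψ hψ => ?_
    · simp only [F, hf]
      congr 1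
      exact Finset.sum_congr rfl fun χ hχ => by rw [Irr_apply_conj ((hI χ).mp hχ)]
    · simp only [F, sub_mul, Finset.sum_sub_distrib, Finset.sum_mul, mul_assoc, ← Finset.mul_sum]
      rw [Finset.sum_comm]
      have : ∀ χ ∈ I, ∑ x, (∑ z, f z * χ z⁻¹) * (χ x * ψ x⁻¹) =
          if χ = ψ then (∑ z, f z * χ z⁻¹) * Nat.card G else 0 := by
        intro χ hχ
        rw [← Finset.mul_sum, sum_Irr_mul_inv ((hI χ).mp hχ) hψ, mul_ite, mul_zero]
      simp only [← mul_assoc, ← Finset.sum_mul] at this ⊢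
      simp only [mul_assoc] at this ⊢
      rw [Finset.sum_congr rfl this, Finset.sum_ite_eq' I, if_pos ((hI ψ).mpr hψ)]
      ring
  exact sub_eq_zero.mp (congrFun hF y)

theorem card_conjClasses_le_ncard_Irr [Finite G] : Nat.card (ConjClasses G) ≤ (Irr G).ncard := by
  classical
  cases nonempty_fintype G
  let I := (Irr_finite G).toFinset
  have hI : ∀ χ, χ ∈ I ↔ χ ∈ Irr G := fun χ => (Irr_finite G).mem_toFinset
  let Φ : (I → ℂ) →ₗ[ℂ] (G → ℂ) := Fintype.linearCombination ℂ fun χ : I => (χ : G → ℂ)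
  let Ψ : (ConjClasses G → ℂ) →ₗ[ℂ] (G → ℂ) := LinearMap.funLeft ℂ ℂ ConjClasses.mk
  have hΨ : Function.Injective Ψ :=
    LinearMap.funLeft_injective_of_surjective ℂ ℂ _ ConjClasses.mk_surjective
  have hG : (Nat.card G : ℂ) ≠ 0 := by exact_mod_cast Nat.card_pos.ne'
  have hle : LinearMap.range Ψ ≤ LinearMap.range Φ := by
    rintro _ ⟨f, rfl⟩
    have hcl : ∀ g x, Ψ f (g * x * g⁻¹) = Ψ f x := fun g x => by
      simp only [Ψ, LinearMap.funLeft_apply]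
      congr 1
      exact ConjClasses.mk_eq_mk_iff_isConj.mpr (isConj_iff.mpr ⟨g, rfl⟩).symm
    refine ⟨fun χ => (Nat.card G : ℂ)⁻¹ * ∑ x, Ψ f x * (χ : G → ℂ) x⁻¹, ?_⟩
    ext y
    rw [Fintype.linearCombination_apply, Finset.sum_apply]
    simp only [Pi.smul_apply, smul_eq_mul, mul_assoc]
    rw [← Finset.mul_sum, inv_mul_eq_iff_eq_mul₀ hG, card_mul_eq_sum_Irr hI hcl,
      ← Finset.sum_coe_sort I]
  have h1 := Submodule.finrank_mono hle
  rw [LinearMap.finrank_range_of_inj hΨ] at h1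
  have h2 := h1.trans (LinearMap.finrank_range_le Φ)
  rw [Module.finrank_fintype_fun_eq_card, Module.finrank_fintype_fun_eq_card] at h2
  rw [Nat.card_eq_fintype_card, Set.ncard_eq_toFinset_card _ (Irr_finite G)]
  simpa [I] using h2

theorem Irr_apply_inv [Finite G] {χ : G → ℂ} (hχ : χ ∈ Irr G) (g : G) :
    χ g⁻¹ = (starRingEnd ℂ) (χ g) := by
  obtain ⟨V, _, _, _, ρ, hρ, rfl⟩ := hχ
  exact ρ.character_inv g

/-- Column orthogonality, obtained by expanding the indicator of the class of g in irreducible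
characters and evaluating at g. -/
theorem ncard_conjugatesOf_mul_sum_Irr_norm_sq [Finite G] {I : Finset (G → ℂ)}
    (hI : ∀ χ, χ ∈ I ↔ χ ∈ Irr G) (g : G) :
    ((conjugatesOf g).ncard : ℝ) * ∑ χ ∈ I, ‖χ g‖ ^ 2 = Nat.card G := by
  classical
  cases nonempty_fintype G
  have h := card_mul_eq_sum_Irr hI (f := fun x => if IsConj g x then 1 else 0) (fun a x => by
    have : IsConj x (a * x * a⁻¹) := isConj_iff.mpr ⟨a, rfl⟩
    exact if_congr ⟨fun h => h.trans this.symm, fun h => h.trans this⟩ rfl rfl) g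
  simp only [IsConj.refl, if_true, mul_one] at h
  have hχ : ∀ χ ∈ I, ∑ x, (if IsConj g x then 1 else 0) * χ x⁻¹ =
      (conjugatesOf g).ncard * (starRingEnd ℂ) (χ g) := by
    intro χ hχ
    have : ∀ x, (if IsConj g x then (1 : ℂ) else 0) * χ x⁻¹ =
        if IsConj g x then (starRingEnd ℂ) (χ g) else 0 := by
      intro x
      rw [ite_mul, one_mul, zero_mul, Irr_apply_inv ((hI χ).mp hχ)]
      refine ite_congr rfl (fun hx => ?_) fun _ => rfl
      obtain ⟨a, rfl⟩ := isConj_iff.mp hx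
      rw [Irr_apply_conj ((hI χ).mp hχ)]
    simp only [this]
    rw [← Finset.sum_filter, Finset.sum_const, nsmul_eq_mul, Set.ncard_eq_toFinset_card']
    congr 3
    ext x
    rw [Set.mem_toFinset, Finset.mem_filter]
    exact ⟨fun h => h.2, fun h => ⟨Finset.mem_univ _, h⟩⟩
  rw [Finset.sum_congr rfl fun χ hχ' => by rw [hχ χ hχ']] at h
  apply Complex.ofReal_injective
  push_cast
  rw [h, Finset.mul_sum]
  refine Finset.sum_congr rfl fun χ _ => ?_
  rw [mul_assoc, Complex.conj_mul']

/-! ### Consequences of nilpotency -/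

/-- In the decomposition into Sylow subgroups, each coordinate of x or of y is trivial. -/
theorem commute_of_coprime_orderOf [Finite G] [Group.IsNilpotent G] {x y : G}
    (h : (orderOf x).Coprime (orderOf y)) : Commute x y := by
  obtain ⟨e⟩ := (Group.isNilpotent_of_finite_tfae (G := G)).out 0 4 |>.mp ‹_›
  refine (commute_map_iff e.symm.injective).mp ?_
  refine funext fun p => funext fun P => ?_
  have : Fact (p : ℕ).Prime := ⟨Nat.prime_of_mem_primeFactors p.2⟩
  have hdvd (z : G) : orderOf (e.symm z p P) ∣ orderOf z := by
    refine orderOf_dvd_of_pow_eq_one ?_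
    have h1 : e.symm z ^ orderOf z = 1 := by rw [← map_pow, pow_orderOf_eq_one, map_one]
    exact congrFun (congrFun h1 p) P
  have hcop := Nat.Coprime.of_dvd (hdvd x) (hdvd y) h
  obtain ⟨k, hk⟩ := IsPGroup.iff_orderOf.mp P.isPGroup' (e.symm x p P)
  obtain ⟨l, hl⟩ := IsPGroup.iff_orderOf.mp P.isPGroup' (e.symm y p P)
  rcases Nat.eq_zero_or_pos k with rfl | hk0
  · rw [pow_zero, orderOf_eq_one_iff] at hk
    simp [hk]
  rcases Nat.eq_zero_or_pos l with rfl | hl0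
  · rw [pow_zero, orderOf_eq_one_iff] at hl
    simp [hl]
  rw [hk, hl, Nat.coprime_pow_left_iff hk0, Nat.coprime_pow_right_iff hl0,
    Nat.coprime_self] at hcop
  exact absurd hcop this.out.ne_one

section Scalar

variable {V : Type*} [AddCommGroup V] [Module ℂ V] (ρ : Representation ℂ G V)

/-- The elements of the group that a representation maps to scalars. -/
def Representation.scalarSubgroup : Subgroup G where
  carrier := {g | ∃ c : ℂ, ρ g = c • 1}
  one_mem' := ⟨1, by simp⟩
  mul_mem' := by
    rintro a b ⟨c, hc⟩ ⟨d, hd⟩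
    exact ⟨c * d, by rw [map_mul, hc, hd, smul_mul_smul_comm, one_mul]⟩
  inv_mem' := by
    rintro a ⟨c, hc⟩
    refine ⟨c⁻¹, ?_⟩
    have h : ρ a⁻¹ * ρ a = 1 := by rw [← map_mul, inv_mul_cancel, map_one]
    rw [hc, mul_smul_comm, mul_one] at h
    by_cases h0 : c = 0
    · rw [h0, zero_smul] at h
      rw [← mul_one (ρ a⁻¹), ← h]; simp
    · rw [← h, smul_smul, inv_mul_cancel₀ h0, one_smul]

instance : ρ.scalarSubgroup.Normal where
  conj_mem := by
    rintro n ⟨c, hc⟩ g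
    exact ⟨c, by
      rw [map_mul, map_mul, hc, mul_smul_comm, mul_one, smul_mul_assoc, ← map_mul,
        mul_inv_cancel, map_one]⟩

variable {ρ}

theorem pow_commutator_eq_smul {h x : G} {c : ℂ} (hc : ρ h * ρ x = c • (ρ x * ρ h)) (k l : ℕ) :
    ρ (h ^ k) * ρ (x ^ l) = c ^ (k * l) • (ρ (x ^ l) * ρ (h ^ k)) := by
  have h1 (k : ℕ) : ρ (h ^ k) * ρ x = c ^ k • (ρ x * ρ (h ^ k)) := by
    induction k with
    | zero => simp
    | succ k ih =>
      rw [pow_succ, map_mul, mul_assoc, hc, mul_smul_comm, ← mul_assoc, ih, smul_mul_assoc,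
        smul_smul, mul_assoc, pow_succ' c]
  induction l with
  | zero => simp
  | succ l ih =>
    rw [pow_succ, map_mul, ← mul_assoc, ih, smul_mul_assoc, mul_assoc, h1, mul_smul_comm, smul_smul,
      mul_assoc, mul_add, pow_add, mul_one]

theorem Representation.IsIrreducible.scalarSubgroup_ne_top (hρ : ρ.IsIrreducible)
    (hV : Module.finrank ℂ V ≠ 1) : ρ.scalarSubgroup ≠ ⊤ := by
  intro htop
  obtain ⟨v, hv⟩ : ∃ v : V, v ≠ 0 := by
    by_contra! hc
    refine hρ.exists_pair_ne.elim fun W ⟨W', hW⟩ => hW ?_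
    refine SetLike.ext fun v => ?_
    rw [hc v]
    exact ⟨fun _ => W'.toSubmodule.zero_mem, fun _ => W.toSubmodule.zero_mem⟩
  let W : Subrepresentation ρ := ⟨Submodule.span ℂ {v}, fun g w hw => by
    obtain ⟨c, hc⟩ : g ∈ ρ.scalarSubgroup := htop ▸ Subgroup.mem_top g
    rw [hc]
    exact Submodule.smul_mem _ c hw⟩
  rcases hρ.eq_bot_or_eq_top W with h | h
  · have h1 : Submodule.span ℂ {v} = ⊥ := congrArg Subrepresentation.toSubmodule h
    exact hv (Submodule.span_singleton_eq_bot.mp h1)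
  · have h1 : Submodule.span ℂ {v} = ⊤ := congrArg Subrepresentation.toSubmodule h
    exact hV (by rw [← finrank_top ℂ V, ← h1, finrank_span_singleton hv])

/-- Modulo the elements acting as scalars, G is nontrivial and nilpotent, so it has a central h ≠ 1.
Its commutators act as scalars, and not all are trivial, since otherwise Schur would make ρ(h)
scalar. -/
theorem Representation.IsIrreducible.exists_commutator_eq_smul [FiniteDimensional ℂ V]
    [Group.IsNilpotent G] (hρ : ρ.IsIrreducible) (hV : Module.finrank ℂ V ≠ 1) :
    ∃ (h x : G) (c : ℂ), c ≠ 1 ∧ ρ h * ρ x = c • (ρ x * ρ h) := by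
  have : Nontrivial (G ⧸ ρ.scalarSubgroup) :=
    QuotientGroup.nontrivial_iff.mpr (hρ.scalarSubgroup_ne_top hV)
  obtain ⟨q, hq, hq1⟩ := (Subgroup.bot_or_exists_ne_one
    (Subgroup.center (G ⧸ ρ.scalarSubgroup))).resolve_left (Group.IsNilpotent.center_ne_bot _)
  obtain ⟨h, hh⟩ := QuotientGroup.mk_surjective q
  rw [← hh] at hq hq1
  rw [ne_eq, QuotientGroup.eq_one_iff] at hq1
  have hex : ∃ x, ρ h * ρ x ≠ ρ x * ρ h := by
    by_contra! hc
    exact hq1 (hρ.exists_eq_smul_one hc)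
  obtain ⟨x, hx⟩ := hex
  have hcomm : (x * h)⁻¹ * (h * x) ∈ ρ.scalarSubgroup := by
    rw [← QuotientGroup.eq]
    exact Subgroup.mem_center_iff.mp hq x
  obtain ⟨c, hc⟩ := hcomm
  have hmul : ρ h * ρ x = c • (ρ x * ρ h) := by
    rw [← map_mul, ← map_mul, ← mul_inv_cancel_left (x * h) (h * x), map_mul, hc, mul_smul_comm,
      mul_one]
  refine ⟨h, x, c, ?_, hmul⟩
  rintro rfl
  exact hx (by rw [hmul, one_smul])

theorem Representation.IsIrreducible.exists_prime_pow_commutator [FiniteDimensional ℂ V]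
    [Finite G] [Group.IsNilpotent G] (hρ : ρ.IsIrreducible) (hV : Module.finrank ℂ V ≠ 1) :
    ∃ (p m n : ℕ) (h x : G) (z : ℂ), p.Prime ∧ Nat.card G = p ^ m * p * n ∧ p.Coprime n ∧
      h ^ (p ^ m * p) = 1 ∧ x ^ (p ^ m * p) = 1 ∧ IsPrimitiveRoot z p ∧
      ρ h * ρ x = z • (ρ x * ρ h) := by
  obtain ⟨h, x, c, hc1, hc⟩ := hρ.exists_commutator_eq_smul hV
  have hG : Nat.card G ≠ 0 := Nat.card_pos.ne'
  have hcN : c ^ Nat.card G = 1 := by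
    have hV0 : Nontrivial V := by
      by_contra hs
      rw [not_nontrivial_iff_subsingleton] at hs
      refine hρ.exists_pair_ne.elim fun W ⟨W', hW⟩ => hW ?_
      exact Subrepresentation.toSubmodule_injective (Subsingleton.elim _ _)
    have h1 := pow_commutator_eq_smul hc (Nat.card G) 1
    rw [pow_card_eq_one', map_one, one_mul, mul_one, pow_one, mul_one] at h1
    obtain ⟨v, hv⟩ := exists_ne (0 : V)
    have h2 := LinearMap.congr_fun h1 (ρ x⁻¹ v)
    rw [LinearMap.smul_apply, ← Module.End.mul_apply, ← map_mul, mul_inv_cancel, map_one,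
      Module.End.one_apply] at h2
    by_contra hne
    refine hv ((smul_eq_zero.mp (?_ : (c ^ Nat.card G - 1) • v = 0)).resolve_left
      (sub_ne_zero.mpr hne))
    rw [sub_smul, ← h2, one_smul, sub_self]
  have hr1 : orderOf c ≠ 1 := fun h => hc1 (orderOf_eq_one_iff.mp h)
  have hrN : orderOf c ∣ Nat.card G := orderOf_dvd_of_pow_eq_one hcN
  have hr0 : 0 < orderOf c := Nat.pos_of_ne_zero fun h => hG (by rw [h] at hrN; simpa using hrN)
  obtain ⟨p, hp, hpr⟩ := Nat.exists_prime_and_dvd hr1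
  obtain ⟨k, hk⟩ := hpr
  have hz : IsPrimitiveRoot (c ^ k) p :=
    (IsPrimitiveRoot.orderOf c).pow hr0 (by rw [hk, mul_comm])
  obtain ⟨s, n, hn, hs⟩ := Nat.exists_eq_pow_mul_and_not_dvd hG p hp.ne_one
  have hs0 : s ≠ 0 := by
    rintro rfl
    rw [pow_zero, one_mul] at hs
    exact hn (hs ▸ (Dvd.intro k hk.symm).trans hrN)
  obtain ⟨m, rfl⟩ := Nat.exists_eq_succ_of_ne_zero hs0
  have hcop : p.Coprime n := (hp.coprime_iff_not_dvd).mpr hn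
  rw [Nat.succ_eq_add_one, pow_succ] at hs
  -- The exponent k lowers the order of c to p, and n, the part of |G| prime to p, makes both
  -- elements p-elements. The commutator becomes c^(n·kn), still primitive because n is prime to p.
  refine ⟨p, m, n, h ^ n, x ^ (k * n), (c ^ k) ^ (n * n), hp, hs, hcop, ?_, ?_, ?_, ?_⟩
  · rw [← pow_mul, mul_comm n, ← hs, pow_card_eq_one']
  · rw [← pow_mul, mul_assoc, mul_comm n, ← hs, mul_comm, pow_mul, pow_card_eq_one', one_pow]
  · exact hz.pow_of_coprime _ (hcop.symm.mul_left hcop.symm)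
  · rw [pow_commutator_eq_smul hc, ← pow_mul]
    congr 2
    ring

end Scalar

/-! ### Splitting g and its Galois conjugates by the Chinese remainder theorem -/

theorem exists_commute_mul_eq_of_coprime {g : G} {q n : ℕ} (hqn : q.Coprime n)
    (hg : g ^ (q * n) = 1) : ∃ a b : G, Commute a b ∧ a * b = g ∧ a ^ q = 1 ∧ b ^ n = 1 := by
  obtain ⟨k, hk1, hk0⟩ := Nat.chineseRemainder hqn 1 0
  obtain ⟨l, hl0, hl1⟩ := Nat.chineseRemainder hqn 0 1
  refine ⟨g ^ k, g ^ l, (Commute.refl g).pow_pow k l, ?_, ?_, ?_⟩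
  · have h : k + l ≡ 1 [MOD q * n] :=
      (Nat.modEq_and_modEq_iff_modEq_mul hqn).mp ⟨hk1.add hl0, hk0.add hl1⟩
    rw [← pow_add]
    conv_rhs => rw [← pow_one g]
    exact pow_eq_pow_iff_modEq.mpr (h.of_dvd (orderOf_dvd_of_pow_eq_one hg))
  · obtain ⟨d, rfl⟩ := (Nat.modEq_zero_iff_dvd).mp hk0
    rw [← pow_mul, show n * d * q = q * n * d by ring, pow_mul, hg, one_pow]
  · obtain ⟨d, rfl⟩ := (Nat.modEq_zero_iff_dvd).mp hl0
    rw [← pow_mul, show q * d * n = q * n * d by ring, pow_mul, hg, one_pow]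

theorem sum_units_pow_eq_sum_sum {a b : G} (hab : Commute a b) {q n : ℕ} [NeZero q] [NeZero n]
    [NeZero (q * n)] (hqn : q.Coprime n) (ha : a ^ q = 1) (hb : b ^ n = 1) (f : G → ℝ) :
    ∑ k : (ZMod (q * n))ˣ, f ((a * b) ^ (k : ZMod (q * n)).val) =
      ∑ i : (ZMod q)ˣ, ∑ j : (ZMod n)ˣ,
        f (a ^ (i : ZMod q).val * b ^ (j : ZMod n).val) := by
  let E : (ZMod (q * n))ˣ ≃* (ZMod q)ˣ × (ZMod n)ˣ :=
    (Units.mapEquiv (ZMod.chineseRemainder hqn).toMulEquiv).trans MulEquiv.prodUnits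
  rw [← Fintype.sum_prod_type', ← E.toEquiv.sum_comp]
  refine Finset.sum_congr rfl fun k _ => ?_
  have h1 : ((E k).1 : ZMod q) = ((k : ZMod (q * n)).val : ZMod q) := by
    have : ((E k).1 : ZMod q) = (ZMod.chineseRemainder hqn (k : ZMod (q * n))).1 := rfl
    rw [this]
    conv_lhs => rw [← ZMod.natCast_zmod_val (k : ZMod (q * n))]
    rw [map_natCast, Prod.fst_natCast]
  have h2 : ((E k).2 : ZMod n) = ((k : ZMod (q * n)).val : ZMod n) := by
    have : ((E k).2 : ZMod n) = (ZMod.chineseRemainder hqn (k : ZMod (q * n))).2 := rfl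
    rw [this]
    conv_lhs => rw [← ZMod.natCast_zmod_val (k : ZMod (q * n))]
    rw [map_natCast, Prod.snd_natCast]
  simp only [MulEquiv.toEquiv_eq_coe, EquivLike.coe_coe, h1, h2, ZMod.val_natCast]
  rw [hab.mul_pow, ← pow_eq_pow_mod _ ha, ← pow_eq_pow_mod _ hb]

theorem two_mul_totient_le_sum_norm_sq [Finite G] [Group.IsNilpotent G] [NeZero (Nat.card G)]
    {χ : G → ℂ} (hχ : χ ∈ nonlinearIrr G) {g : G} (hg : χ g ≠ 0) :
    2 * (Fintype.card (ZMod (Nat.card G))ˣ : ℝ) ≤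
      ∑ k : (ZMod (Nat.card G))ˣ, ‖χ (g ^ (k : ZMod (Nat.card G)).val)‖ ^ 2 := by
  obtain ⟨⟨V, _, _, _, ρ, hρ, rfl⟩, h1⟩ := hχ
  have hV : Module.finrank ℂ V ≠ 1 := fun h => h1 (by rw [ρ.char_one, h, Nat.cast_one])
  obtain ⟨p, m, n, h, x, z, hp, hN, hpn, hh, hx, hz, hhx⟩ := hρ.exists_prime_pow_commutator hV
  have hqn : (p ^ m * p).Coprime n := by
    rw [← pow_succ]; exact hpn.pow_left _
  have hgN : g ^ (p ^ m * p * n) = 1 := by rw [← hN, pow_card_eq_one']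
  obtain ⟨a, b, hab, rfl, ha, hb⟩ := exists_commute_mul_eq_of_coprime hqn hgN
  have hcomm (y : G) (hy : y ^ (p ^ m * p) = 1) : Commute b y :=
    commute_of_coprime_orderOf (Nat.Coprime.of_dvd (orderOf_dvd_of_pow_eq_one hb)
      (orderOf_dvd_of_pow_eq_one hy) hqn.symm)
  have hq0 : NeZero (p ^ m * p) := ⟨mul_ne_zero (pow_ne_zero _ hp.ne_zero) hp.ne_zero⟩
  have hn0 : NeZero n := ⟨by rintro rfl; exact NeZero.ne (Nat.card G) (by rw [hN, mul_zero])⟩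
  have key := two_mul_card_units_le_sum_character_norm_sq ρ hp rfl hab ha hb (hcomm h hh)
    (hcomm x hx) hz hhx ⟨1, 1, by
      rw [Units.val_one, Units.val_one, ZMod.val_one_eq_one_mod, ZMod.val_one_eq_one_mod,
        ← pow_eq_pow_mod _ ha, ← pow_eq_pow_mod _ hb, pow_one, pow_one]
      exact hg⟩
  generalize Nat.card G = N at *
  subst hN
  rw [sum_units_pow_eq_sum_sum hab hqn ha hb fun y => ‖ρ.character y‖ ^ 2]
  refine le_trans (le_of_eq ?_) key
  simp only [ZMod.card_units_eq_totient]
  rw [Nat.totient_mul hqn, Nat.cast_mul, mul_assoc]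

/-! ### Counting characters -/

theorem norm_eq_one_of_mem_Irr_of_apply_one [Finite G] {χ : G → ℂ} (hχ : χ ∈ Irr G)
    (h1 : χ 1 = 1) (g : G) : ‖χ g‖ = 1 := by
  obtain ⟨V, _, _, _, ρ, hρ, rfl⟩ := hχ
  rw [ρ.char_one] at h1
  have hV : Module.finrank ℂ V = 1 := by exact_mod_cast h1
  have hdet : ρ.character g = LinearMap.det (ρ g) := by
    obtain ⟨c, hc⟩ := (LinearMap.existsUnique_eq_smul_id_of_finrank_eq_one hV (ρ g)).exists
    rw [Representation.character, hc, map_smul, LinearMap.det_smul, hV, LinearMap.trace_id, hV,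
      LinearMap.det_id]
    simp
  refine Complex.norm_eq_one_of_pow_eq_one (n := Nat.card G) ?_ Nat.card_pos.ne'
  rw [hdet, ← map_pow, ← map_pow, pow_card_eq_one', map_one, map_one]

/-- The k-th power map is a bijection of G that respects conjugation. -/
theorem conjugatesOf_pow_ncard_eq [Finite G] (g : G) {k : ℕ} (hk : k.Coprime (Nat.card G)) :
    (conjugatesOf (g ^ k)).ncard = (conjugatesOf g).ncard := by
  have himage : conjugatesOf (g ^ k) = (fun x => x ^ k) '' conjugatesOf g := by
    ext y
    simp only [conjugatesOf, Set.mem_ofPred_eq, Set.mem_image, isConj_iff]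
    constructor
    · rintro ⟨c, rfl⟩
      exact ⟨c * g * c⁻¹, ⟨c, rfl⟩, conj_pow⟩
    · rintro ⟨_, ⟨c, rfl⟩, rfl⟩
      exact ⟨c, conj_pow.symm⟩
  rw [himage]
  exact Set.ncard_image_of_injective _ (powCoprime hk.symm).injective

theorem two_mul_card_nonvanishing_add_card_linear_le [Finite G] [Group.IsNilpotent G]
    {I : Finset (G → ℂ)} (hI : ∀ χ, χ ∈ I ↔ χ ∈ Irr G) (g : G) :
    ((conjugatesOf g).ncard : ℝ) * (2 * ({χ ∈ nonlinearIrr G | χ g ≠ 0}.ncard : ℝ) +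
      {χ ∈ Irr G | χ 1 = 1}.ncard) ≤ Nat.card G := by
  classical
  have hN : NeZero (Nat.card G) := ⟨Nat.card_pos.ne'⟩
  let M := {χ ∈ I | χ 1 ≠ 1 ∧ χ g ≠ 0}
  let L := {χ ∈ I | χ 1 = 1}
  have hM : ({χ ∈ nonlinearIrr G | χ g ≠ 0}.ncard : ℝ) = M.card := by
    rw [← Set.ncard_coe_finset]
    congr 2
    ext χ
    simp [M, nonlinearIrr, hI, and_assoc]
  have hL : ({χ ∈ Irr G | χ 1 = 1}.ncard : ℝ) = L.card := by
    rw [← Set.ncard_coe_finset]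
    congr 2
    ext χ
    simp [L, hI]
  have hLM : Disjoint M L := Finset.disjoint_filter.mpr fun χ _ h h' => h.1 h'
  have hsub : M ∪ L ⊆ I := Finset.union_subset (Finset.filter_subset _ _) (Finset.filter_subset _ _)
  set u := (Fintype.card (ZMod (Nat.card G))ˣ : ℝ) with hu
  have hu0 : 0 < u := by rw [hu]; exact_mod_cast Fintype.card_pos
  have hsum : u * (2 * M.card + L.card) ≤
      ∑ k : (ZMod (Nat.card G))ˣ, ∑ χ ∈ I, ‖χ (g ^ (k : ZMod (Nat.card G)).val)‖ ^ 2 := by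
    rw [Finset.sum_comm]
    refine le_trans ?_ (Finset.sum_le_sum_of_subset_of_nonneg hsub fun _ _ _ => by positivity)
    rw [Finset.sum_union hLM]
    have hMle := Finset.card_nsmul_le_sum M
      (fun χ => ∑ k : (ZMod (Nat.card G))ˣ, ‖χ (g ^ (k : ZMod (Nat.card G)).val)‖ ^ 2) (2 * u)
      fun χ hχ => by
        rw [Finset.mem_filter, hI] at hχ
        exact two_mul_totient_le_sum_norm_sq ⟨hχ.1, hχ.2.1⟩ hχ.2.2
    have hLle := Finset.card_nsmul_le_sum L
      (fun χ => ∑ k : (ZMod (Nat.card G))ˣ, ‖χ (g ^ (k : ZMod (Nat.card G)).val)‖ ^ 2) u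
      fun χ hχ => by
        rw [Finset.mem_filter, hI] at hχ
        simp [norm_eq_one_of_mem_Irr_of_apply_one hχ.1 hχ.2, hu]
    rw [nsmul_eq_mul] at hMle hLle
    linarith
  have horth : ((conjugatesOf g).ncard : ℝ) *
      ∑ k : (ZMod (Nat.card G))ˣ, ∑ χ ∈ I, ‖χ (g ^ (k : ZMod (Nat.card G)).val)‖ ^ 2 =
      u * Nat.card G := by
    rw [Finset.mul_sum, Finset.sum_congr rfl fun k _ => by
      rw [← conjugatesOf_pow_ncard_eq g (ZMod.val_coe_unit_coprime k),
        ncard_conjugatesOf_mul_sum_Irr_norm_sq hI]]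
    simp [hu]
  rw [hM, hL]
  refine le_of_mul_le_mul_left ?_ hu0
  rw [← horth, mul_left_comm]
  exact mul_le_mul_of_nonneg_left hsum (Nat.cast_nonneg _)

end FiniteGroup

theorem theorem2 (G : Type*) [Group G] [Finite G] [Group.IsNilpotent G] (g : G) :
    (((conjugatesOf g).ncard : ℚ) > (Nat.card G : ℚ) / (Nat.card (ConjClasses G) : ℚ) →
      ({χ ∈ nonlinearIrr G | χ g = 0}.ncard : ℚ) > ((nonlinearIrr G).ncard : ℚ) / 2) ∧
    (((conjugatesOf g).ncard : ℚ) = (Nat.card G : ℚ) / (Nat.card (ConjClasses G) : ℚ) →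
      ({χ ∈ nonlinearIrr G | χ g = 0}.ncard : ℚ) ≥ ((nonlinearIrr G).ncard : ℚ) / 2) := by
  have hfin := Irr_finite G
  have hnl : (nonlinearIrr G).Finite := hfin.subset fun χ h => h.1
  have hsplit : {χ ∈ nonlinearIrr G | χ g = 0}.ncard + {χ ∈ nonlinearIrr G | χ g ≠ 0}.ncard =
      (nonlinearIrr G).ncard := by
    rw [← Set.ncard_union_eq (Set.disjoint_left.mpr fun χ h h' => h'.2 h.2)
      (hnl.subset fun χ h => h.1) (hnl.subset fun χ h => h.1)]
    congr 1
    ext χ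
    simp only [Set.mem_union, Set.mem_ofPred_eq]
    tauto
  have hlin : {χ ∈ Irr G | χ 1 = 1}.ncard + (nonlinearIrr G).ncard = (Irr G).ncard := by
    rw [← Set.ncard_union_eq (Set.disjoint_left.mpr fun χ h h' => h'.2 h.2)
      (hfin.subset fun χ h => h.1) hnl]
    congr 1
    ext χ
    simp only [nonlinearIrr, Set.mem_union, Set.mem_ofPred_eq]
    tauto
  have hbound : (conjugatesOf g).ncard * (2 * {χ ∈ nonlinearIrr G | χ g ≠ 0}.ncard +
      {χ ∈ Irr G | χ 1 = 1}.ncard) ≤ Nat.card G := by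
    exact_mod_cast two_mul_card_nonvanishing_add_card_linear_le
      (I := hfin.toFinset) (fun χ => hfin.mem_toFinset) g
  have hcl := card_conjClasses_le_ncard_Irr (G := G)
  have hk : (0 : ℚ) < Nat.card (ConjClasses G) := by exact_mod_cast Nat.card_pos
  have hc : 0 < (conjugatesOf g).ncard :=
    (Set.ncard_pos (Set.toFinite _)).mpr ⟨g, mem_conjugatesOf_self⟩
  generalize {χ ∈ nonlinearIrr G | χ g = 0}.ncard = z at *
  generalize {χ ∈ nonlinearIrr G | χ g ≠ 0}.ncard = w at *
  generalize {χ ∈ Irr G | χ 1 = 1}.ncard = l at *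
  constructor
  · intro h
    rw [gt_iff_lt, div_lt_iff₀ hk] at h
    have h' : Nat.card G < (conjugatesOf g).ncard * Nat.card (ConjClasses G) := by
      exact_mod_cast h
    -- Thus 2w + l < |Cl(G)| ≤ |Irr(G)| = l + w + z, whence w < z.
    have h2 := Nat.lt_of_mul_lt_mul_left (hbound.trans_lt h')
    rw [gt_iff_lt, div_lt_iff₀ two_pos]
    exact_mod_cast (by omega : (nonlinearIrr G).ncard < z * 2)
  · intro h
    rw [eq_div_iff hk.ne'] at h
    have h' : (conjugatesOf g).ncard * Nat.card (ConjClasses G) = Nat.card G := by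
      exact_mod_cast h
    have h2 := Nat.le_of_mul_le_mul_left (h' ▸ hbound) hc
    rw [ge_iff_le, div_le_iff₀ two_pos]
    exact_mod_cast (by omega : (nonlinearIrr G).ncard ≤ z * 2)
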